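/- Let $T^2=S^1\times S^1$ with $S^1=\{z\in\mathbb C:|z|=1\}$, and let $\pi\colon\mathbb R^2\to T^2$, $\pi(\theta_1,\theta_2)=(e^{i\theta_1},e^{i\theta_2})$, be its universal covering. A lifting of a map $\Psi\colon T^2\to T^2$ is a continuous map $\widetilde\Psi\colon\mathbb R^2\to\mathbb R^2$ with $\pi\circ\widetilde\Psi=\Psi\circ\pi$. Let $h\colon\mathbb R^2\to\mathbb R$ be real analytic and $2\pi$-periodic in each variable, put $\mu(\theta)=\theta_1+h(\theta)$ for $\theta=(\theta_1,\theta_2)\in\mathbb R^2$, and assume that $d\mu$ vanishes nowhere. Then there is a real analytic diffeomorphism $\Psi$ of $T^2$ with a lifting $\widetilde\Psi$ such that $$\mu\circ\widetilde\Psi(\theta)=\theta_1\qquad\text{for all }\theta\in\mathbb R^2 .$$ Moreover, every analytic circle fibration $\tau\colon T^2\to S^1$, that is, every real analytic submersion with connected fibres, is analytically trivial: there is a real analytic diffeomorphism $\Psi$ of $T^2=S^1\times S^1$ with $\tau(\Psi(z_1,z_2))=z_1$ for all $(z_1,z_2)\in T^2$. -/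

import Mathlib

open scoped Manifold ContDiff

/-- The two-dimensional torus `T² = S¹ × S¹`, with Mathlib's analytic manifold structure on the
unit circle `S¹ ⊆ ℂ` and the product structure. -/
abbrev Torus2 : Type := Circle × Circle

/-- The universal covering `ℝ² → T²`, `(θ₁, θ₂) ↦ (e^{iθ₁}, e^{iθ₂})`. -/
noncomputable def torusCover (θ : ℝ × ℝ) : Torus2 :=
  (Circle.exp θ.1, Circle.exp θ.2)

/-- `F : ℝ² → ℝ²` is a (continuous) lifting of `φ : T² → T²` to the universal covering. -/
def IsTorusLifting (F : ℝ × ℝ → ℝ × ℝ) (φ : Torus2 → Torus2) : Prop :=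
  Continuous F ∧ ∀ θ : ℝ × ℝ, torusCover (F θ) = φ (torusCover θ)

/-- `h` is `2π`-periodic in each of its two variables. -/
def IsTwoPiPeriodic (h : ℝ × ℝ → ℝ) : Prop :=
  ∀ x y : ℝ, h (x + 2 * Real.pi, y) = h (x, y) ∧ h (x, y + 2 * Real.pi) = h (x, y)

/-- An analytic circle fibration `τ : T² → S¹`: a real analytic submersion with connected fibres.
(As `T²` is compact, the fibres are then circles.) -/
structure IsAnalyticCircleFibration (τ : Torus2 → Circle) : Prop where
  analytic : ContMDiff ((𝓡 1).prod (𝓡 1)) (𝓡 1) ω τ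
  submersion : ∀ z : Torus2,
    Function.Surjective (mfderiv ((𝓡 1).prod (𝓡 1)) (𝓡 1) τ z)
  connected_fibre : ∀ w : Circle, IsConnected (τ ⁻¹' {w})

/-- Analytic diffeomorphisms of the torus. -/
abbrev TorusAnalyticDiffeo : Type :=
  Diffeomorph ((𝓡 1).prod (𝓡 1)) ((𝓡 1).prod (𝓡 1)) Torus2 Torus2 ω

/-!
The flow of the gradient of `μ`, normalised so that `μ` grows with unit speed, retracts the plane
onto each level set of `μ`; so `μ` is onto and its level sets are connected. Being connected, each
level set is a single orbit of the Hamiltonian flow of `μ`. This orbit contains all translates of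
its points by `(0, 2πn)`, so it is never periodic, and the time needed to reach the translate by
`(0, 2π)` is a continuous periodic function of constant sign. Up to reversing time, the second
coordinate therefore increases by a definite amount along the flow over some fixed time `T`.

Averaging the second coordinate over the orbit segment of length `T` gives a function which
increases along the levels. Averaging over a fine Euler polygon instead preserves that, and yields
a `ν` whose analyticity does not rely on the analytic dependence of flows on initial values. Then
`(μ, ν)` is an analytic diffeomorphism of the plane commuting with lattice translations, and its
inverse descends to the torus.

A circle fibration `τ` lifts to `m : ℝ² → ℝ` without critical points, which is periodic up to a
linear form `a x₁ + b x₂` with integer coefficients. The form is not zero, since otherwise `m` would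
have a maximum. A unimodular change of coordinates turns it into `d x₁` with `d = gcd a b`, and the
first part applied to `m / d` makes `τ` equal to `z₁ ^ d`. Connected fibres force `d = 1`.
-/

open Set Filter Topology
open scoped NNReal

section Flow

variable {E : Type*} [NormedAddCommGroup E] [NormedSpace ℝ E] {V : E → E} {K L : ℝ≥0}

theorem exists_forall_mem_Ioo_hasDerivAt [CompleteSpace E] (hV : LipschitzWith K V)
    (hL : ∀ x, ‖V x‖ ≤ L) (x : E) (n : ℕ) : ∃ γ : ℝ → E, γ 0 = x ∧
      ∀ t ∈ Ioo (-((n : ℝ) + 1)) ((n : ℝ) + 1), HasDerivAt γ (V (γ t)) t := by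
  have h0 : (0 : ℝ) ∈ Icc (-((n : ℝ) + 1)) ((n : ℝ) + 1) := by constructor <;> linarith
  have hp : IsPicardLindelof (fun _ : ℝ => V) (⟨0, h0⟩ : Icc (-((n : ℝ) + 1)) ((n : ℝ) + 1)) x
      (L * (n + 1)) 0 L K :=
    .of_time_independent (fun y _ => hL y) hV.lipschitzOnWith (by simp)
  obtain ⟨γ, hγ0, hγ⟩ := hp.exists_eq_forall_mem_Icc_hasDerivWithinAt₀
  exact ⟨γ, hγ0, fun t ht =>
    (hγ t (Ioo_subset_Icc_self ht)).hasDerivAt (Icc_mem_nhds ht.1 ht.2)⟩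

theorem exists_forall_hasDerivAt [CompleteSpace E] (hV : LipschitzWith K V)
    (hL : ∀ x, ‖V x‖ ≤ L) (x : E) :
    ∃ γ : ℝ → E, γ 0 = x ∧ ∀ t, HasDerivAt γ (V (γ t)) t := by
  choose γ hγ0 hγ using exists_forall_mem_Ioo_hasDerivAt hV hL x
  have agree {m n : ℕ} (hmn : m ≤ n) {t : ℝ} (ht : |t| < m + 1) : γ m t = γ n t := by
    have hmn' : (m : ℝ) ≤ n := by exact_mod_cast hmn
    exact ODE_solution_unique_of_mem_Ioo (v := fun _ => V) (s := fun _ => univ) (t₀ := 0)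
      (fun _ _ => hV.lipschitzOnWith) ⟨by linarith, by linarith⟩
      (fun s hs => ⟨hγ m s hs, trivial⟩)
      (fun s hs => ⟨hγ n s ⟨by linarith [hs.1], by linarith [hs.2]⟩, trivial⟩)
      ((hγ0 m).trans (hγ0 n).symm) (abs_lt.1 ht)
  refine ⟨fun t => γ ⌊|t|⌋₊ t, hγ0 _, fun t => ?_⟩
  have ht : |t| < (⌊|t|⌋₊ : ℝ) + 1 := Nat.lt_floor_add_one _
  refine (hγ ⌊|t|⌋₊ t (abs_lt.1 ht)).congr_of_eventuallyEq ?_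
  filter_upwards [continuous_abs.continuousAt.eventually_lt continuousAt_const ht] with s hs
  have : ⌊|s|⌋₊ < ⌊|t|⌋₊ + 1 := (Nat.floor_lt (abs_nonneg _)).2 (by exact_mod_cast hs)
  exact agree (by lia) (Nat.lt_floor_add_one _)

theorem dist_le_mul_exp_of_hasDerivAt (hV : LipschitzWith K V) {γ₁ γ₂ : ℝ → E}
    (h₁ : ∀ t, HasDerivAt γ₁ (V (γ₁ t)) t) (h₂ : ∀ t, HasDerivAt γ₂ (V (γ₂ t)) t) (t : ℝ) :
    dist (γ₁ t) (γ₂ t) ≤ dist (γ₁ 0) (γ₂ 0) * Real.exp (K * |t|) := by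
  have forward {V : E → E} {γ₁ γ₂ : ℝ → E} (hV : LipschitzWith K V)
      (h₁ : ∀ t, HasDerivAt γ₁ (V (γ₁ t)) t) (h₂ : ∀ t, HasDerivAt γ₂ (V (γ₂ t)) t) {t : ℝ}
      (ht : 0 ≤ t) : dist (γ₁ t) (γ₂ t) ≤ dist (γ₁ 0) (γ₂ 0) * Real.exp (K * t) := by
    simpa only [sub_zero] using dist_le_of_trajectories_ODE (v := fun _ => V) (fun _ => hV)
      (fun s _ => (h₁ s).continuousAt.continuousWithinAt) (fun s _ => (h₁ s).hasDerivWithinAt)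
      (fun s _ => (h₂ s).continuousAt.continuousWithinAt) (fun s _ => (h₂ s).hasDerivWithinAt)
      le_rfl t ⟨ht, le_rfl⟩
  rcases le_total 0 t with ht | ht
  · simpa only [abs_of_nonneg ht] using forward hV h₁ h₂ ht
  · have reversed {γ : ℝ → E} (h : ∀ t, HasDerivAt γ (V (γ t)) t) (t : ℝ) :
        HasDerivAt (fun s => γ (-s)) (-V (γ (-t))) t := by
      simpa only [neg_smul, one_smul, Function.comp_def] using (h (-t)).scomp t (hasDerivAt_neg t)
    simpa only [abs_of_nonpos ht, neg_neg, neg_zero] using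
      forward hV.neg (reversed h₁) (reversed h₂) (neg_nonneg.2 ht)

theorem eq_of_hasDerivAt_of_eq_zero (hV : LipschitzWith K V) {γ₁ γ₂ : ℝ → E}
    (h₁ : ∀ t, HasDerivAt γ₁ (V (γ₁ t)) t) (h₂ : ∀ t, HasDerivAt γ₂ (V (γ₂ t)) t)
    (h0 : γ₁ 0 = γ₂ 0) (t : ℝ) : γ₁ t = γ₂ t :=
  dist_le_zero.1 (by simpa [h0] using dist_le_mul_exp_of_hasDerivAt hV h₁ h₂ t)

theorem norm_sub_le_of_hasDerivAt (hL : ∀ x, ‖V x‖ ≤ L) {γ : ℝ → E}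
    (h : ∀ t, HasDerivAt γ (V (γ t)) t) (s t : ℝ) : ‖γ t - γ s‖ ≤ L * |t - s| :=
  convex_univ.norm_image_sub_le_of_norm_hasDerivWithin_le
    (fun u _ => (h u).hasDerivWithinAt) (fun _ _ => hL _) (mem_univ s) (mem_univ t)

/-- The orbits of the flow `ψ` are the solutions of the autonomous equation `x' = V x`. -/
def IsFlowOf (V : E → E) (ψ : Flow ℝ E) : Prop :=
  ∀ x t, HasDerivAt (fun s => ψ s x) (V (ψ t x)) t

theorem exists_isFlowOf [CompleteSpace E] (hV : LipschitzWith K V) (hL : ∀ x, ‖V x‖ ≤ L) :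
    ∃ ψ, IsFlowOf V ψ := by
  choose γ hγ0 hγ using exists_forall_hasDerivAt hV hL
  have hcont : Continuous fun p : E × ℝ => γ p.1 p.2 := by
    refine continuous_prod_of_continuous_lipschitzWith' _ L (fun x => ?_) (fun t => ?_)
    · exact .of_dist_le_mul fun s t => by
        simpa only [dist_eq_norm, Real.norm_eq_abs] using norm_sub_le_of_hasDerivAt hL (hγ x) t s
    · refine (LipschitzWith.of_dist_le_mul
        (K := (Real.exp (K * |t|)).toNNReal) fun x y => ?_).continuous
      simpa only [hγ0, Real.coe_toNNReal _ (Real.exp_pos _).le, mul_comm] using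
        dist_le_mul_exp_of_hasDerivAt hV (hγ x) (hγ y) t
  refine ⟨⟨fun t x => γ x t, hcont.comp continuous_swap, fun s t x => ?_, hγ0⟩, hγ⟩
  exact eq_of_hasDerivAt_of_eq_zero hV (fun u => (hγ x (u + t)).comp_add_const u t)
    (hγ (γ x t)) (by simp [hγ0]) s

namespace IsFlowOf

variable {ψ : Flow ℝ E}

theorem reverse (h : IsFlowOf V ψ) : IsFlowOf (-V) ψ.reverse := fun x t => by
  simpa only [neg_smul, one_smul, Function.comp_def, Flow.reverse_apply, Pi.neg_apply] using
    (h x (-t)).scomp t (hasDerivAt_neg t)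

theorem hasDerivAt_comp {F : Type*} [NormedAddCommGroup F] [NormedSpace ℝ F]
    (h : IsFlowOf V ψ) {g : E → F} (hg : Differentiable ℝ g) (x : E) (t : ℝ) :
    HasDerivAt (fun s => g (ψ s x)) (fderiv ℝ g (ψ t x) (V (ψ t x))) t :=
  (hg _).hasFDerivAt.comp_hasDerivAt t (h x t)

theorem translate (h : IsFlowOf V ψ) (hV : LipschitzWith K V) {v : E} (hv : V.Periodic v)
    (t : ℝ) (x : E) : ψ t (x + v) = ψ t x + v :=
  eq_of_hasDerivAt_of_eq_zero hV (γ₂ := fun s => ψ s x + v) (h (x + v))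
    (fun s => by simpa only [hv (ψ s x)] using (h x s).add_const v)
    (by simp only [ψ.map_zero_apply]) t

theorem norm_apply_sub_le (h : IsFlowOf V ψ) (hL : ∀ x, ‖V x‖ ≤ L) (t : ℝ) (x : E) :
    ‖ψ t x - x‖ ≤ L * |t| := by
  simpa only [ψ.map_zero_apply, sub_zero] using norm_sub_le_of_hasDerivAt hL (h x) 0 t

theorem norm_apply_sub_add_smul_le (h : IsFlowOf V ψ) (hV : LipschitzWith K V)
    (hL : ∀ x, ‖V x‖ ≤ L) {s : ℝ} (hs : 0 ≤ s) (x : E) :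
    ‖ψ s x - (x + s • V x)‖ ≤ K * L * s ^ 2 := by
  have hd (u : ℝ) : HasDerivAt (fun u => ψ u x - u • V x) (V (ψ u x) - V x) u := by
    simpa only [one_smul] using (h x u).fun_sub ((hasDerivAt_id' u).smul_const (V x))
  have hb (u : ℝ) (hu : u ∈ Ico 0 s) : ‖V (ψ u x) - V x‖ ≤ K * (L * s) := by
    calc ‖V (ψ u x) - V x‖ ≤ K * ‖ψ u x - x‖ := hV.norm_sub_le _ _
      _ ≤ K * (L * |u|) := by gcongr; exact h.norm_apply_sub_le hL u x
      _ ≤ K * (L * s) := by rw [abs_of_nonneg hu.1]; gcongr; exact hu.2.le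
  calc ‖ψ s x - (x + s • V x)‖ = ‖(ψ s x - s • V x) - (ψ 0 x - (0 : ℝ) • V x)‖ := by
        rw [ψ.map_zero_apply]; congr 1; module
    _ ≤ K * (L * s) * (s - 0) := norm_image_sub_le_of_norm_deriv_le_segment'
        (fun u _ => (hd u).hasDerivWithinAt) hb s ⟨hs, le_rfl⟩
    _ = K * L * s ^ 2 := by ring

end IsFlowOf

end Flow

section Lattice

/-- The vector `2πk` of the period lattice `(2πℤ)²` of the covering `ℝ² → T²`. -/
noncomputable def latticeVec (k : ℤ × ℤ) : ℝ × ℝ := (2 * Real.pi * k.1, 2 * Real.pi * k.2)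

/-- Invariance under the lattice `(2πℤ)²`: the functions on `ℝ²` that descend to the torus. -/
def LatticePeriodic {X : Type*} (f : ℝ × ℝ → X) : Prop :=
  ∀ k, Function.Periodic f (latticeVec k)

theorem exists_add_latticeVec_mem (x : ℝ × ℝ) :
    ∃ k, x + latticeVec k ∈ Icc 0 (2 * Real.pi) ×ˢ Icc 0 (2 * Real.pi) := by
  have reduce (t : ℝ) : ∃ m : ℤ, t + 2 * Real.pi * m ∈ Icc 0 (2 * Real.pi) := by
    refine ⟨-toIcoDiv Real.two_pi_pos 0 t, ?_⟩
    have hmod := Ico_subset_Icc_self (toIcoMod_mem_Ico Real.two_pi_pos 0 t)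
    rw [zero_add, ← self_sub_toIcoDiv_zsmul, zsmul_eq_mul] at hmod
    convert hmod using 1
    push_cast
    ring
  obtain ⟨m, hm⟩ := reduce x.1
  obtain ⟨n, hn⟩ := reduce x.2
  exact ⟨(m, n), hm, hn⟩

theorem IsTwoPiPeriodic.latticePeriodic {h : ℝ × ℝ → ℝ} (hh : IsTwoPiPeriodic h) :
    LatticePeriodic h := fun k x => by
  have h₁ : Function.Periodic (fun t => h (t, x.2 + k.2 * (2 * Real.pi))) (2 * Real.pi) :=
    fun t => (hh t _).1
  have h₂ : Function.Periodic (fun t => h (x.1, t)) (2 * Real.pi) := fun t => (hh _ t).2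
  simpa only [latticeVec, Prod.add_def, mul_comm (2 * Real.pi)] using
    (h₁.int_mul k.1 x.1).trans (h₂.int_mul k.2 x.2)

theorem latticePeriodic_fderiv {F : Type*} [NormedAddCommGroup F] [NormedSpace ℝ F]
    {f : ℝ × ℝ → F} {c : ℤ × ℤ → F} (hf : ∀ x k, f (x + latticeVec k) = f x + c k) :
    LatticePeriodic (fderiv ℝ f) := fun k x => by
  rw [← fderiv_comp_add_right]
  simp only [hf, fderiv_add_const]

theorem symm_apply_add_latticeVec {F : ℝ × ℝ ≃ ℝ × ℝ} {e : ℤ × ℤ ≃ ℤ × ℤ}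
    (hF : ∀ x k, F (x + latticeVec k) = F x + latticeVec (e k)) (x : ℝ × ℝ) (k : ℤ × ℤ) :
    F.symm (x + latticeVec k) = F.symm x + latticeVec (e.symm k) := by
  rw [F.symm_apply_eq, hF, F.apply_symm_apply, e.apply_symm_apply]

namespace LatticePeriodic

theorem isCompact_range {X : Type*} [TopologicalSpace X] {f : ℝ × ℝ → X} (hf : LatticePeriodic f)
    (hc : Continuous f) : IsCompact (range f) := by
  have : range f = f '' Icc 0 (2 * Real.pi) ×ˢ Icc 0 (2 * Real.pi) := by
    refine (range_subset_iff.2 fun x => ?_).antisymm (image_subset_range _ _)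
    obtain ⟨k, hk⟩ := exists_add_latticeVec_mem x
    exact ⟨_, hk, hf k x⟩
  exact this ▸ (isCompact_Icc.prod isCompact_Icc).image hc

theorem exists_norm_le {F : Type*} [SeminormedAddGroup F] {f : ℝ × ℝ → F}
    (hf : LatticePeriodic f) (hc : Continuous f) : ∃ C : ℝ≥0, ∀ x, ‖f x‖ ≤ C := by
  obtain ⟨C, hC⟩ := (hf.isCompact_range hc).isBounded.exists_norm_le
  exact ⟨C.toNNReal, fun x => (hC _ (mem_range_self x)).trans C.le_coe_toNNReal⟩

theorem exists_pos_le {f : ℝ × ℝ → ℝ} (hf : LatticePeriodic f) (hc : Continuous f)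
    (hpos : ∀ x, 0 < f x) : ∃ δ > 0, ∀ x, δ ≤ f x := by
  obtain ⟨-, ⟨x, rfl⟩, hx⟩ := (hf.isCompact_range hc).exists_isLeast (range_nonempty f)
  exact ⟨f x, hpos x, fun y => hx (mem_range_self y)⟩

variable {F : Type*} [NormedAddCommGroup F] [NormedSpace ℝ F]

theorem exists_lipschitzWith {f : ℝ × ℝ → F} (hf : LatticePeriodic f) (hc : ContDiff ℝ 1 f) :
    ∃ K, LipschitzWith K f := by
  have hf' : LatticePeriodic (fderiv ℝ f) :=
    latticePeriodic_fderiv (c := 0) fun x k => by simpa using hf k x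
  obtain ⟨K, hK⟩ := hf'.exists_norm_le (hc.continuous_fderiv one_ne_zero)
  exact ⟨K, lipschitzWith_of_nnnorm_fderiv_le (hc.differentiable one_ne_zero) hK⟩

theorem exists_isFlowOf {V : ℝ × ℝ → ℝ × ℝ} (hV : LatticePeriodic V) (hc : ContDiff ℝ 1 V) :
    ∃ ψ, IsFlowOf V ψ := by
  obtain ⟨K, hK⟩ := hV.exists_lipschitzWith hc
  obtain ⟨L, hL⟩ := hV.exists_norm_le hc.continuous
  exact _root_.exists_isFlowOf hK hL

theorem flow_add_latticeVec {V : ℝ × ℝ → ℝ × ℝ} (hV : LatticePeriodic V) (hc : ContDiff ℝ 1 V)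
    {ψ : Flow ℝ (ℝ × ℝ)} (hψ : IsFlowOf V ψ) (t : ℝ) (x : ℝ × ℝ) (k : ℤ × ℤ) :
    ψ t (x + latticeVec k) = ψ t x + latticeVec k := by
  obtain ⟨K, hK⟩ := hV.exists_lipschitzWith hc
  exact hψ.translate hK (hV k) t x

end LatticePeriodic

end Lattice

section Submersion

variable {μ : ℝ × ℝ → ℝ}

/-- A function of the form `μ(θ) = θ₁ + h(θ)` as in the theorem: real analytic, without critical
points, and with `h` periodic. -/
structure IsPeriodicSubmersion (μ : ℝ × ℝ → ℝ) : Prop where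
  contDiff : ContDiff ℝ ω μ
  periodic : LatticePeriodic fun x => μ x - x.1
  fderiv_ne_zero : ∀ x, fderiv ℝ μ x ≠ 0

/-- A nowhere vanishing periodic analytic vector field along the level curves of `μ`. -/
structure IsTangentField (μ : ℝ × ℝ → ℝ) (Z : ℝ × ℝ → ℝ × ℝ) : Prop where
  contDiff : ContDiff ℝ ω Z
  periodic : LatticePeriodic Z
  fderiv_apply : ∀ x, fderiv ℝ μ x (Z x) = 0
  ne_zero : ∀ x, Z x ≠ 0

/-- The Hamiltonian vector field of `μ`. -/
noncomputable def hamiltonianField (μ : ℝ × ℝ → ℝ) (x : ℝ × ℝ) : ℝ × ℝ :=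
  (-fderiv ℝ μ x (0, 1), fderiv ℝ μ x (1, 0))

/-- The Euclidean gradient of `μ` divided by its squared length, so that `μ` grows with unit speed
along its orbits. -/
noncomputable def unitSpeedGradient (μ : ℝ × ℝ → ℝ) (x : ℝ × ℝ) : ℝ × ℝ :=
  (fderiv ℝ μ x (1, 0) ^ 2 + fderiv ℝ μ x (0, 1) ^ 2)⁻¹ •
    (fderiv ℝ μ x (1, 0), fderiv ℝ μ x (0, 1))

theorem map_prod_eq_fst_mul_add_snd_mul (f : ℝ × ℝ →L[ℝ] ℝ) (v : ℝ × ℝ) :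
    f v = v.1 * f (1, 0) + v.2 * f (0, 1) := by
  conv_lhs => rw [show v = v.1 • ((1, 0) : ℝ × ℝ) + v.2 • ((0, 1) : ℝ × ℝ) by ext <;> simp]
  simp only [map_add, map_smul, smul_eq_mul]

theorem isInvertible_prod_of_apply_eq_zero {E : Type*} [NormedAddCommGroup E] [NormedSpace ℝ E]
    (hE : Module.finrank ℝ E = 2) {f ℓ : E →L[ℝ] ℝ} {z : E} (hf : f ≠ 0) (hz : f z = 0)
    (hℓ : ℓ z ≠ 0) : (f.prod ℓ).IsInvertible := by
  have : FiniteDimensional ℝ E := .of_finrank_pos (by lia)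
  have hker : Module.finrank ℝ f.toLinearMap.ker = 1 := by
    have := Module.Dual.finrank_ker_add_one_of_ne_zero (f := f.toLinearMap)
      fun h => hf (ContinuousLinearMap.coe_injective h)
    lia
  have hinj : Function.Injective (f.prod ℓ).toLinearMap := by
    refine (injective_iff_map_eq_zero _).2 fun v hv => ?_
    obtain ⟨hfv, hℓv⟩ : f v = 0 ∧ ℓ v = 0 := Prod.ext_iff.1 hv
    have hz0 : (⟨z, hz⟩ : f.toLinearMap.ker) ≠ 0 := by
      rintro h
      obtain rfl : z = 0 := congrArg Subtype.val h
      exact hℓ (map_zero ℓ)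
    obtain ⟨c, hc⟩ := (finrank_eq_one_iff_of_nonzero' _ hz0).1 hker ⟨v, hfv⟩
    obtain rfl : c • z = v := congrArg Subtype.val hc
    have : c = 0 := by simpa [hℓ] using hℓv
    simp [this]
  exact ⟨((f.prod ℓ).toLinearMap.linearEquivOfInjective hinj
    (by simp [hE])).toContinuousLinearEquiv, by ext <;> rfl⟩

theorem IsTangentField.neg {Z : ℝ × ℝ → ℝ × ℝ} (hZ : IsTangentField μ Z) :
    IsTangentField μ (-Z) where
  contDiff := hZ.contDiff.neg
  periodic k x := congrArg Neg.neg (hZ.periodic k x)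
  fderiv_apply x := by rw [Pi.neg_apply, map_neg, hZ.fderiv_apply, neg_zero]
  ne_zero x := neg_ne_zero.2 (hZ.ne_zero x)

namespace IsPeriodicSubmersion

theorem differentiable (h : IsPeriodicSubmersion μ) : Differentiable ℝ μ :=
  h.contDiff.differentiable (by simp)

theorem add_latticeVec (h : IsPeriodicSubmersion μ) (x : ℝ × ℝ) (k : ℤ × ℤ) :
    μ (x + latticeVec k) = μ x + 2 * Real.pi * k.1 := by
  have := h.periodic k x
  simp only [Prod.fst_add, latticeVec] at this ⊢
  linarith

theorem fderiv_periodic (h : IsPeriodicSubmersion μ) : LatticePeriodic (fderiv ℝ μ) :=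
  latticePeriodic_fderiv h.add_latticeVec

theorem contDiff_fderiv_apply (h : IsPeriodicSubmersion μ) (v : ℝ × ℝ) :
    ContDiff ℝ ω fun x => fderiv ℝ μ x v :=
  (h.contDiff.fderiv_right le_top).clm_apply contDiff_const

theorem fderiv_apply_ne_zero_or (h : IsPeriodicSubmersion μ) (x : ℝ × ℝ) :
    fderiv ℝ μ x (1, 0) ≠ 0 ∨ fderiv ℝ μ x (0, 1) ≠ 0 := by
  by_contra! hx
  refine h.fderiv_ne_zero x (ContinuousLinearMap.ext fun v => ?_)
  rw [map_prod_eq_fst_mul_add_snd_mul, hx.1, hx.2]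
  simp

theorem sq_add_sq_ne_zero (h : IsPeriodicSubmersion μ) (x : ℝ × ℝ) :
    fderiv ℝ μ x (1, 0) ^ 2 + fderiv ℝ μ x (0, 1) ^ 2 ≠ 0 := by
  rcases h.fderiv_apply_ne_zero_or x with hx | hx <;> positivity

theorem isTangentField_hamiltonianField (h : IsPeriodicSubmersion μ) :
    IsTangentField μ (hamiltonianField μ) where
  contDiff := (h.contDiff_fderiv_apply _).neg.prodMk (h.contDiff_fderiv_apply _)
  periodic k x := by simp only [hamiltonianField, h.fderiv_periodic k x]
  fderiv_apply x := by
    rw [map_prod_eq_fst_mul_add_snd_mul, hamiltonianField]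
    ring
  ne_zero x hx := by
    rw [hamiltonianField, Prod.mk_eq_zero, neg_eq_zero] at hx
    exact (h.fderiv_apply_ne_zero_or x).elim (· hx.2) (· hx.1)

theorem contDiff_unitSpeedGradient (h : IsPeriodicSubmersion μ) :
    ContDiff ℝ ω (unitSpeedGradient μ) :=
  have h₁ := h.contDiff_fderiv_apply (1, 0)
  have h₂ := h.contDiff_fderiv_apply (0, 1)
  (((h₁.pow 2).add (h₂.pow 2)).inv h.sq_add_sq_ne_zero).smul (h₁.prodMk h₂)

theorem unitSpeedGradient_periodic (h : IsPeriodicSubmersion μ) :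
    LatticePeriodic (unitSpeedGradient μ) := fun k x => by
  simp only [unitSpeedGradient, h.fderiv_periodic k x]

theorem fderiv_unitSpeedGradient (h : IsPeriodicSubmersion μ) (x : ℝ × ℝ) :
    fderiv ℝ μ x (unitSpeedGradient μ x) = 1 := by
  have := h.sq_add_sq_ne_zero x
  rw [unitSpeedGradient, map_smul, map_prod_eq_fst_mul_add_snd_mul _ (fderiv ℝ μ x (1, 0), _),
    smul_eq_mul]
  field_simp

end IsPeriodicSubmersion

end Submersion

section FlowBox

variable {E : Type*} [NormedAddCommGroup E] [NormedSpace ℝ E] {V : E → E} {ψ : Flow ℝ E}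

theorem IsFlowOf.eventually_exists_apply_eq (hψ : IsFlowOf V ψ) (hV : Continuous V) {x₀ : E}
    {ℓ : E →L[ℝ] ℝ} (hℓ : ℓ (V x₀) ≠ 0) {U : Set E} (hU : U ∈ 𝓝 x₀) {ε : ℝ} (hε : 0 < ε) :
    ∀ᶠ p : E × E in 𝓝 (x₀, x₀), ∃ s, |s| < ε ∧ ψ s p.1 ∈ U ∧ ℓ (ψ s p.1) = ℓ p.2 := by
  have hnear : ∀ᶠ q : ℝ × E in 𝓝 (0, x₀), ψ q.1 q.2 ∈ U :=
    ψ.cont'.continuousAt.eventually_mem (by simpa using hU)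
  obtain ⟨r, hr, hball⟩ := Metric.eventually_nhds_iff_ball.1 hnear
  obtain ⟨ρ, hρ, hρr, hρε⟩ : ∃ ρ > 0, ρ ≤ r ∧ ρ ≤ ε := ⟨min r ε, by positivity, by simp⟩
  have hderiv (s : ℝ) : HasDerivAt (fun s => ℓ (ψ s x₀)) (ℓ (V (ψ s x₀))) s := by
    simpa only [ℓ.fderiv] using hψ.hasDerivAt_comp ℓ.differentiable x₀ s
  have hcont : Continuous fun s => ℓ (V (ψ s x₀)) := by fun_prop
  have hstrict := hasStrictDerivAt_of_hasDerivAt_of_continuousAt (x := 0)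
    (.of_forall hderiv) hcont.continuousAt
  have himage : (fun s => ℓ (ψ s x₀)) '' Ioo (-ρ) ρ ∈ 𝓝 (ℓ x₀) := by
    have := image_mem_map (m := fun s => ℓ (ψ s x₀)) (Ioo_mem_nhds (neg_lt_zero.2 hρ) hρ)
    rwa [hstrict.map_nhds_eq (by simpa using hℓ), ψ.map_zero_apply] at this
  obtain ⟨-, hlow, s₁, hs₁, rfl⟩ := Eventually.exists_lt himage
  obtain ⟨-, hup, s₂, hs₂, rfl⟩ := Eventually.exists_gt himage
  have hcont' (s : ℝ) : Continuous fun p : E × E => ℓ (ψ s p.1) := by fun_prop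
  have hℓcont : Continuous fun p : E × E => ℓ p.2 := by fun_prop
  filter_upwards [(hcont' s₁).continuousAt.eventually_lt hℓcont.continuousAt hlow,
    hℓcont.continuousAt.eventually_lt (hcont' s₂).continuousAt hup,
    continuous_fst.continuousAt.eventually_mem (Metric.ball_mem_nhds x₀ hr)] with p hp₁ hp₂ hp
  have hpcont : Continuous fun s => ℓ (ψ s p.1) := by fun_prop
  obtain ⟨s, hs, hsp⟩ := intermediate_value_uIcc (f := fun s => ℓ (ψ s p.1)) hpcont.continuousOn
    (mem_uIcc_of_le hp₁.le hp₂.le)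
  have hsρ : |s| < ρ := abs_lt.2 ((convex_Ioo (-ρ) ρ).ordConnected.uIcc_subset hs₁ hs₂ hs)
  have hsr : dist s 0 < r := by simpa using hsρ.trans_le hρr
  exact ⟨s, hsρ.trans_le hρε, hball (s, p.1) (Prod.dist_eq.trans_lt (max_lt hsr hp)), hsp⟩

end FlowBox

section Levels

variable {μ : ℝ × ℝ → ℝ} {Z : ℝ × ℝ → ℝ × ℝ} {ψ : Flow ℝ (ℝ × ℝ)}

namespace IsPeriodicSubmersion

theorem comp_gradientFlow (h : IsPeriodicSubmersion μ) {φ : Flow ℝ (ℝ × ℝ)}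
    (hφ : IsFlowOf (unitSpeedGradient μ) φ) (t : ℝ) (x : ℝ × ℝ) : μ (φ t x) = μ x + t := by
  have hd (s : ℝ) : HasDerivAt (fun s => μ (φ s x) - s) 0 s := by
    simpa only [h.fderiv_unitSpeedGradient, sub_self] using
      (hφ.hasDerivAt_comp h.differentiable x s).fun_sub (hasDerivAt_id' s)
  have := is_const_of_deriv_eq_zero (fun s => (hd s).differentiableAt) (fun s => (hd s).deriv) t 0
  rw [φ.map_zero_apply] at this
  linarith

theorem exists_continuous_retraction (h : IsPeriodicSubmersion μ) (c : ℝ) :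
    ∃ r : ℝ × ℝ → ℝ × ℝ, Continuous r ∧ (∀ x, μ (r x) = c) ∧ ∀ x, μ x = c → r x = x := by
  obtain ⟨φ, hφ⟩ := h.unitSpeedGradient_periodic.exists_isFlowOf
    (h.contDiff_unitSpeedGradient.of_le le_top)
  refine ⟨fun x => φ (c - μ x) x, ?_, fun x => ?_, fun x hx => ?_⟩
  · exact φ.continuous (continuous_const.sub h.contDiff.continuous) continuous_id
  · rw [h.comp_gradientFlow hφ, add_sub_cancel]
  · simp [hx]

theorem surjective (h : IsPeriodicSubmersion μ) : Function.Surjective μ := fun c =>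
  have ⟨r, _, hr, _⟩ := h.exists_continuous_retraction c
  ⟨r 0, hr 0⟩

theorem isPreconnected_level (h : IsPeriodicSubmersion μ) (c : ℝ) :
    IsPreconnected {x | μ x = c} := by
  obtain ⟨r, hr, hrc, hrfix⟩ := h.exists_continuous_retraction c
  convert isPreconnected_univ.image r hr.continuousOn
  exact Subset.antisymm (fun x hx => ⟨x, trivial, hrfix x hx⟩)
    (image_subset_iff.2 fun x _ => hrc x)

theorem comp_flow (h : IsPeriodicSubmersion μ) (hZ : IsTangentField μ Z) (hψ : IsFlowOf Z ψ)
    (t : ℝ) (x : ℝ × ℝ) : μ (ψ t x) = μ x := by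
  have hd (s : ℝ) : HasDerivAt (fun s => μ (ψ s x)) 0 s := by
    simpa only [hZ.fderiv_apply] using hψ.hasDerivAt_comp h.differentiable x s
  simpa only [ψ.map_zero_apply] using
    is_const_of_deriv_eq_zero (fun s => (hd s).differentiableAt) (fun s => (hd s).deriv) t 0

theorem eventually_exists_flow_eq (h : IsPeriodicSubmersion μ) (hZ : IsTangentField μ Z)
    (hψ : IsFlowOf Z ψ) (x₀ : ℝ × ℝ) {ε : ℝ} (hε : 0 < ε) :
    ∀ᶠ p : (ℝ × ℝ) × (ℝ × ℝ) in 𝓝 (x₀, x₀), μ p.1 = μ p.2 → ∃ s, |s| < ε ∧ ψ s p.1 = p.2 := by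
  obtain ⟨ℓ, hℓ⟩ := SeparatingDual.exists_ne_zero (R := ℝ) (hZ.ne_zero x₀)
  obtain ⟨A, hA⟩ := isInvertible_prod_of_apply_eq_zero (by simp) (h.fderiv_ne_zero x₀)
    (hZ.fderiv_apply x₀) hℓ
  have hG : HasStrictFDerivAt (fun x => (μ x, ℓ x)) (A : ℝ × ℝ →L[ℝ] ℝ × ℝ) x₀ := hA ▸
    (h.contDiff.contDiffAt.hasStrictFDerivAt (by simp)).prodMk ℓ.hasStrictFDerivAt
  have hU : hG.toOpenPartialHomeomorph.source ∈ 𝓝 x₀ :=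
    hG.toOpenPartialHomeomorph.open_source.mem_nhds hG.mem_toOpenPartialHomeomorph_source
  filter_upwards [hψ.eventually_exists_apply_eq hZ.contDiff.continuous hℓ hU hε,
    continuous_snd.continuousAt.eventually_mem hU] with p ⟨s, hs, hsU, hsℓ⟩ hpU hμ
  refine ⟨s, hs, hG.toOpenPartialHomeomorph.injOn hsU hpU ?_⟩
  exact Prod.ext ((h.comp_flow hZ hψ s p.1).trans hμ) hsℓ

theorem exists_flow_eq (h : IsPeriodicSubmersion μ) (hZ : IsTangentField μ Z)
    (hψ : IsFlowOf Z ψ) {x y : ℝ × ℝ} (hxy : μ x = μ y) : ∃ t, ψ t x = y := by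
  refine (h.isPreconnected_level (μ y)).induction₂ (fun x y => ∃ t, ψ t x = y) ?_ ?_ ?_ hxy rfl
  · intro z hz
    have hloc := h.eventually_exists_flow_eq hZ hψ z one_pos
    rw [nhds_prod_eq] at hloc
    filter_upwards [nhdsWithin_le_nhds hloc.curry.self_of_nhds, self_mem_nhdsWithin] with w hw hw'
    exact (hw (hz.trans hw'.symm)).imp fun s hs => hs.2
  · rintro a - - - - - ⟨s, rfl⟩ ⟨t, rfl⟩
    exact ⟨t + s, ψ.map_add _ _ _⟩
  · rintro a - - - ⟨s, rfl⟩
    exact ⟨-s, by rw [← ψ.map_add, neg_add_cancel, ψ.map_zero_apply]⟩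

theorem exists_flow_eq_add_latticeVec (h : IsPeriodicSubmersion μ) (hZ : IsTangentField μ Z)
    (hψ : IsFlowOf Z ψ) (x : ℝ × ℝ) (n : ℤ) : ∃ t, ψ t x = x + latticeVec (0, n) :=
  h.exists_flow_eq hZ hψ (by simp [h.add_latticeVec])

theorem flow_time_injective (h : IsPeriodicSubmersion μ) (hZ : IsTangentField μ Z)
    (hψ : IsFlowOf Z ψ) (x : ℝ × ℝ) : Function.Injective fun t => ψ t x := by
  intro s t hst
  by_contra hne
  have hper : Function.Periodic (fun u => ψ u x) (s - t) := fun u => by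
    simp only
    rw [show u + (s - t) = (u - t) + s by ring, ψ.map_add, show ψ s x = ψ t x from hst,
      ← ψ.map_add, sub_add_cancel]
  obtain ⟨C, hC⟩ := ((hper.compact_of_continuous (sub_ne_zero.2 hne)
    (by fun_prop)).image continuous_snd).bddAbove
  obtain ⟨n, hn⟩ := exists_nat_gt (C - x.2)
  obtain ⟨u, hu⟩ := h.exists_flow_eq_add_latticeVec hZ hψ x n
  have hle : x.2 + 2 * Real.pi * n ≤ C := by
    simpa [hu, latticeVec] using hC ⟨_, ⟨u, rfl⟩, rfl⟩
  nlinarith [Real.pi_gt_three, (n.cast_nonneg : (0 : ℝ) ≤ n)]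

end IsPeriodicSubmersion

end Levels

section ReturnTime

variable {V : ℝ × ℝ → ℝ × ℝ} {ψ : Flow ℝ (ℝ × ℝ)}

theorem returnTime_pos_or_neg {T : ℝ × ℝ → ℝ} (hc : Continuous T)
    (hT : ∀ x, ψ (T x) x = x + latticeVec (0, 1)) : (∀ x, 0 < T x) ∨ ∀ x, T x < 0 := by
  by_contra! ⟨⟨x, hx⟩, y, hy⟩
  obtain ⟨z, hz⟩ := mem_range_of_exists_le_of_exists_ge hc ⟨x, hx⟩ ⟨y, hy⟩
  have := hT z
  simp [hz, latticeVec, Prod.ext_iff, Real.pi_ne_zero] at this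

theorem LatticePeriodic.flow_nat_mul_returnTime_add (hV : LatticePeriodic V) (hc : ContDiff ℝ 1 V)
    (hψ : IsFlowOf V ψ) {x : ℝ × ℝ} {t : ℝ} (ht : ψ t x = x + latticeVec (0, 1)) (n : ℕ) (s : ℝ) :
    ψ (n * t + s) x = ψ s x + latticeVec (0, n) := by
  induction n generalizing s with
  | zero => simp [latticeVec]
  | succ n ih =>
    have hvec : latticeVec (0, 1) + latticeVec (0, n) = latticeVec (0, ↑(n + 1)) := by
      ext <;> simp [latticeVec, mul_add, add_comm]
    rw [show ↑(n + 1) * t + s = n * t + (s + t) by push_cast; ring, ih, ψ.map_add, ht,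
      hV.flow_add_latticeVec hc hψ, add_assoc, hvec]

theorem exists_eq_nat_mul_add {t p : ℝ} (ht : 0 ≤ t) (hp : 0 < p) :
    ∃ (n : ℕ) (s : ℝ), s ∈ Ico 0 p ∧ t = n * p + s := by
  refine ⟨⌊t / p⌋₊, t - ⌊t / p⌋₊ * p, ⟨sub_nonneg.2 ?_, sub_lt_iff_lt_add.2 ?_⟩, by ring⟩
  · exact (le_div_iff₀ hp).1 (Nat.floor_le (div_nonneg ht hp.le))
  · linarith [(div_lt_iff₀ hp).1 (Nat.lt_floor_add_one (t / p))]

theorem LatticePeriodic.exists_forall_snd_lt_flow_snd (hV : LatticePeriodic V)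
    (hc : ContDiff ℝ 1 V) (hψ : IsFlowOf V ψ) {T : ℝ × ℝ → ℝ} (hTc : Continuous T)
    (hTper : LatticePeriodic T) (hpos : ∀ x, 0 < T x)
    (hT : ∀ x, ψ (T x) x = x + latticeVec (0, 1)) : ∃ t > 0, ∀ x, x.2 < (ψ t x).2 := by
  obtain ⟨M, hM⟩ := hTper.exists_norm_le hTc
  obtain ⟨L, hL⟩ := hV.exists_norm_le hc.continuous
  have hTM (x : ℝ × ℝ) : T x ≤ M := (le_abs_self _).trans (hM x)
  have hMpos : (0 : ℝ) < M := (hpos 0).trans_le (hTM 0)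
  obtain ⟨N, hN⟩ := exists_nat_gt ((L : ℝ) * M)
  have hNpos : (0 : ℝ) < N := (by positivity : (0 : ℝ) ≤ L * M).trans_lt hN
  refine ⟨N * M, mul_pos hNpos hMpos, fun x => ?_⟩
  obtain ⟨n, s, ⟨hs0, hs⟩, hns⟩ := exists_eq_nat_mul_add (mul_pos hNpos hMpos).le (hpos x)
  have hNn : (N : ℝ) ≤ n := by
    have : (N : ℝ) * T x < (n + 1) * T x := by
      linarith [mul_le_mul_of_nonneg_left (hTM x) hNpos.le]
    exact_mod_cast Nat.lt_succ_iff.1 (by exact_mod_cast lt_of_mul_lt_mul_right this (hpos x).le)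
  have hdrift : |(ψ s x).2 - x.2| ≤ L * M := by
    calc |(ψ s x).2 - x.2| ≤ ‖ψ s x - x‖ := norm_snd_le (ψ s x - x)
      _ ≤ L * |s| := hψ.norm_apply_sub_le hL s x
      _ ≤ L * M := by rw [abs_of_nonneg hs0]; gcongr; exact hs.le.trans (hTM x)
  rw [hns, hV.flow_nat_mul_returnTime_add hc hψ (hT x), Prod.snd_add]
  simp only [latticeVec, Int.cast_natCast]
  nlinarith [abs_le.1 hdrift, Real.pi_gt_three]

end ReturnTime

section LevelDrift

variable {μ : ℝ × ℝ → ℝ} {Z : ℝ × ℝ → ℝ × ℝ} {ψ : Flow ℝ (ℝ × ℝ)}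

namespace IsPeriodicSubmersion

theorem exists_returnTime (h : IsPeriodicSubmersion μ) (hZ : IsTangentField μ Z)
    (hψ : IsFlowOf Z ψ) :
    ∃ T : ℝ × ℝ → ℝ, Continuous T ∧ LatticePeriodic T ∧
      ∀ x, ψ (T x) x = x + latticeVec (0, 1) := by
  choose T hT using fun x => h.exists_flow_eq_add_latticeVec hZ hψ x 1
  have unique {x : ℝ × ℝ} {t : ℝ} (ht : ψ t x = x + latticeVec (0, 1)) : T x = t :=
    h.flow_time_injective hZ hψ x ((hT x).trans ht.symm)
  refine ⟨T, continuous_iff_continuousAt.2 fun x₀ => ?_, fun k x => unique ?_, hT⟩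
  · refine Metric.tendsto_nhds.2 fun ε hε => ?_
    have hlim : Tendsto (fun y => (ψ (T x₀) y, y + latticeVec (0, 1))) (𝓝 x₀)
        (𝓝 (x₀ + latticeVec (0, 1), x₀ + latticeVec (0, 1))) :=
      Continuous.tendsto' (by fun_prop) _ _ (by rw [hT])
    filter_upwards [hlim.eventually (h.eventually_exists_flow_eq hZ hψ _ hε)] with y hy
    obtain ⟨s, hs, hsy⟩ := hy (by simp [h.comp_flow hZ hψ, h.add_latticeVec])
    rwa [unique (t := s + T x₀) (by rw [ψ.map_add, hsy]), Real.dist_eq, add_sub_cancel_right]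
  · rw [hZ.periodic.flow_add_latticeVec (hZ.contDiff.of_le le_top) hψ, hT]
    abel

theorem exists_isTangentField_returnTime_pos (h : IsPeriodicSubmersion μ) :
    ∃ Z ψ, IsTangentField μ Z ∧ IsFlowOf Z ψ ∧ ∃ T : ℝ × ℝ → ℝ, Continuous T ∧
      LatticePeriodic T ∧ (∀ x, 0 < T x) ∧ ∀ x, ψ (T x) x = x + latticeVec (0, 1) := by
  have hZ := h.isTangentField_hamiltonianField
  obtain ⟨ψ, hψ⟩ := hZ.periodic.exists_isFlowOf (hZ.contDiff.of_le le_top)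
  obtain ⟨T, hTc, hTper, hT⟩ := h.exists_returnTime hZ hψ
  rcases returnTime_pos_or_neg hTc hT with hpos | hneg
  · exact ⟨_, ψ, hZ, hψ, T, hTc, hTper, hpos, hT⟩
  · refine ⟨_, ψ.reverse, hZ.neg, hψ.reverse, fun x => -T x, hTc.neg, fun k x => ?_, fun x => ?_,
      fun x => ?_⟩
    · exact congrArg Neg.neg (hTper k x)
    · exact neg_pos.2 (hneg x)
    · rw [ψ.reverse_apply, neg_neg, hT]

theorem exists_isTangentField_snd_add_le (h : IsPeriodicSubmersion μ) :
    ∃ Z ψ, IsTangentField μ Z ∧ IsFlowOf Z ψ ∧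
      ∃ t > 0, ∃ δ > 0, ∀ x, x.2 + δ ≤ (ψ t x).2 := by
  obtain ⟨Z, ψ, hZ, hψ, T, hc, hper, hpos, hT⟩ := h.exists_isTangentField_returnTime_pos
  obtain ⟨t, ht, hlt⟩ := hZ.periodic.exists_forall_snd_lt_flow_snd (hZ.contDiff.of_le le_top) hψ
    hc hper hpos hT
  have hdisp : LatticePeriodic fun x => (ψ t x).2 - x.2 := fun k x => by
    simp only [hZ.periodic.flow_add_latticeVec (hZ.contDiff.of_le le_top) hψ, Prod.snd_add,
      add_sub_add_right_eq_sub]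
  obtain ⟨δ, hδ, hle⟩ := hdisp.exists_pos_le (by fun_prop) fun x => sub_pos.2 (hlt x)
  exact ⟨Z, ψ, hZ, hψ, t, ht, δ, hδ, fun x => by linarith [hle x]⟩

end IsPeriodicSubmersion

end LevelDrift

section EulerAverage

variable {E : Type*} [NormedAddCommGroup E] [NormedSpace ℝ E] {V : E → E} {K K' L : ℝ≥0} {ε : ℝ}

/-- One step of Euler's method for the equation `x' = V x`, with step size `ε`. -/
def eulerStep (V : E → E) (ε : ℝ) (x : E) : E := x + ε • V x

theorem iterate_eulerStep_translate {v : E} (hv : V.Periodic v) (n : ℕ) (x : E) :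
    (eulerStep V ε)^[n] (x + v) = (eulerStep V ε)^[n] x + v := by
  have hsemi : Function.Semiconj (· + v) (eulerStep V ε) (eulerStep V ε) := fun x => by
    simp only [eulerStep, hv x, add_right_comm]
  exact (hsemi.iterate_right n x).symm

theorem contDiff_iterate_eulerStep {m : WithTop ℕ∞} (hV : ContDiff ℝ m V) (n : ℕ) :
    ContDiff ℝ m (eulerStep V ε)^[n] := by
  induction n with
  | zero => exact contDiff_id
  | succ n ih => exact ih.comp (contDiff_id.add (hV.const_smul ε))

theorem norm_eulerStep_sub_le (hV : LipschitzWith K V) (hε : 0 ≤ ε) (x y : E) :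
    ‖eulerStep V ε x - eulerStep V ε y‖ ≤ (1 + ε * K) * ‖x - y‖ := by
  calc ‖eulerStep V ε x - eulerStep V ε y‖ = ‖(x - y) + ε • (V x - V y)‖ := by
        unfold eulerStep; congr 1; module
    _ ≤ ‖x - y‖ + ε * ‖V x - V y‖ := by
        simpa only [norm_smul_of_nonneg hε] using norm_add_le (x - y) (ε • (V x - V y))
    _ ≤ ‖x - y‖ + ε * (K * ‖x - y‖) := by gcongr; exact hV.norm_sub_le x y
    _ = (1 + ε * K) * ‖x - y‖ := by ring

theorem IsFlowOf.norm_apply_sub_iterate_eulerStep_le {ψ : Flow ℝ E} (h : IsFlowOf V ψ)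
    (hV : LipschitzWith K V) (hL : ∀ x, ‖V x‖ ≤ L) (hε : 0 ≤ ε) (n : ℕ) (x : E) :
    ‖ψ (n * ε) x - (eulerStep V ε)^[n] x‖ ≤ n * (K * L * ε ^ 2) * Real.exp (n * (ε * K)) := by
  have hstep (n : ℕ) : ‖ψ (↑(n + 1) * ε) x - (eulerStep V ε)^[n + 1] x‖ ≤
      (1 + ε * K) * ‖ψ (n * ε) x - (eulerStep V ε)^[n] x‖ + K * L * ε ^ 2 := by
    rw [Function.iterate_succ_apply', Nat.cast_succ, add_one_mul, add_comm (n * ε), ψ.map_add,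
      add_comm _ (K * L * ε ^ 2)]
    exact (norm_sub_le_norm_sub_add_norm_sub _ (eulerStep V ε (ψ (n * ε) x)) _).trans
      (add_le_add (h.norm_apply_sub_add_smul_le hV hL hε _) (norm_eulerStep_sub_le hV hε _ _))
  simpa using discrete_gronwall (u := fun n => ‖ψ (n * ε) x - (eulerStep V ε)^[n] x‖)
    (norm_nonneg _) (fun n _ => hstep n) (fun _ _ => by positivity)
    (fun _ _ => by positivity) n.zero_le

theorem norm_sub_sub_fderiv_le (hd : Differentiable ℝ V) (hV' : LipschitzWith K' (fderiv ℝ V))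
    (x v : E) : ‖V (x + v) - V x - fderiv ℝ V x v‖ ≤ K' * ‖v‖ ^ 2 := by
  have hbound (y : E) (hy : y ∈ Metric.closedBall x ‖v‖) :
      ‖fderiv ℝ V y - fderiv ℝ V x‖ ≤ K' * ‖v‖ :=
    (hV'.norm_sub_le y x).trans (by gcongr; exact mem_closedBall_iff_norm.1 hy)
  simpa only [add_sub_cancel_left, mul_assoc, ← sq] using
    (convex_closedBall x ‖v‖).norm_image_sub_le_of_norm_fderiv_le' (fun y _ => hd y) hbound
      (Metric.mem_closedBall_self (norm_nonneg v)) (y := x + v) (by simp)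

theorem norm_fderiv_eulerStep_sub_le (hd : Differentiable ℝ V) (hV : LipschitzWith K V)
    (hV' : LipschitzWith K' (fderiv ℝ V)) (hL : ∀ x, ‖V x‖ ≤ L) (hε : 0 ≤ ε) (y v : E) :
    ‖fderiv ℝ (eulerStep V ε) y v - V (eulerStep V ε y)‖ ≤
      (1 + ε * K) * ‖v - V y‖ + K' * L ^ 2 * ε ^ 2 := by
  have hE : fderiv ℝ (eulerStep V ε) y = .id ℝ E + ε • fderiv ℝ V y :=
    ((hasFDerivAt_id y).add ((hd y).hasFDerivAt.const_smul ε)).fderiv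
  calc ‖fderiv ℝ (eulerStep V ε) y v - V (eulerStep V ε y)‖
      = ‖(v - V y) + ε • fderiv ℝ V y (v - V y) -
          (V (y + ε • V y) - V y - fderiv ℝ V y (ε • V y))‖ := by
        rw [hE, eulerStep, map_sub, map_smul]
        congr 1
        simp only [add_apply, smul_apply, ContinuousLinearMap.id_apply]
        module
    _ ≤ ‖v - V y‖ + ε * (K * ‖v - V y‖) + K' * (ε * L) ^ 2 := by
        refine norm_sub_le_of_le (norm_add_le_of_le le_rfl ?_)
          ((norm_sub_sub_fderiv_le hd hV' y _).trans ?_)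
        · rw [norm_smul_of_nonneg hε]
          gcongr
          exact (fderiv ℝ V y).le_of_opNorm_le (norm_fderiv_le_of_lipschitz ℝ hV) _
        · rw [norm_smul_of_nonneg hε]
          gcongr
          exact hL y
    _ = (1 + ε * K) * ‖v - V y‖ + K' * L ^ 2 * ε ^ 2 := by ring

theorem norm_fderiv_iterate_eulerStep_sub_le (hd : Differentiable ℝ V) (hV : LipschitzWith K V)
    (hV' : LipschitzWith K' (fderiv ℝ V)) (hL : ∀ x, ‖V x‖ ≤ L) (hε : 0 ≤ ε) (n : ℕ) (x : E) :
    ‖fderiv ℝ (eulerStep V ε)^[n] x (V x) - V ((eulerStep V ε)^[n] x)‖ ≤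
      n * (K' * L ^ 2 * ε ^ 2) * Real.exp (n * (ε * K)) := by
  have hEd : Differentiable ℝ (eulerStep V ε) := differentiable_id.add (hd.const_smul ε)
  have hstep (n : ℕ) :
      ‖fderiv ℝ (eulerStep V ε)^[n + 1] x (V x) - V ((eulerStep V ε)^[n + 1] x)‖ ≤
      (1 + ε * K) * ‖fderiv ℝ (eulerStep V ε)^[n] x (V x) - V ((eulerStep V ε)^[n] x)‖ +
        K' * L ^ 2 * ε ^ 2 := by
    rw [Function.iterate_succ_apply', Function.iterate_succ',
      fderiv_comp x (hEd _) (hEd.iterate n x)]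
    exact norm_fderiv_eulerStep_sub_le hd hV hV' hL hε _ _
  simpa using discrete_gronwall
    (u := fun n => ‖fderiv ℝ (eulerStep V ε)^[n] x (V x) - V ((eulerStep V ε)^[n] x)‖)
    (norm_nonneg _) (fun n _ => hstep n) (fun _ _ => by positivity)
    (fun _ _ => by positivity) n.zero_le

/-- The average of `f` over the first `N` points of the Euler polygon of step size `ε`. It is as
regular as `f` and `V`, and replaces the time average of `f` along the flow of `V`. -/
noncomputable def eulerAverage (V : E → E) (f : E → ℝ) (ε : ℝ) (N : ℕ) (x : E) : ℝ :=
  (∑ j ∈ Finset.range N, f ((eulerStep V ε)^[j] x)) / N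

theorem contDiff_eulerAverage {m : WithTop ℕ∞} (hV : ContDiff ℝ m V) {f : E → ℝ}
    (hf : ContDiff ℝ m f) (N : ℕ) : ContDiff ℝ m (eulerAverage V f ε N) :=
  (ContDiff.sum fun j _ => hf.comp (contDiff_iterate_eulerStep hV j)).div_const _

theorem eulerAverage_translate {v : E} (hv : V.Periodic v) {N : ℕ} (hN : N ≠ 0) (ℓ : E →L[ℝ] ℝ)
    (x : E) : eulerAverage V ℓ ε N (x + v) = eulerAverage V ℓ ε N x + ℓ v := by
  simp only [eulerAverage, iterate_eulerStep_translate hv, map_add, Finset.sum_add_distrib,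
    Finset.sum_const, Finset.card_range, nsmul_eq_mul]
  field_simp

theorem mul_fderiv_eulerAverage_apply (hd : Differentiable ℝ V) (ℓ : E →L[ℝ] ℝ) {N : ℕ}
    (hN : N ≠ 0) (x v : E) : N * ε * fderiv ℝ (eulerAverage V ℓ ε N) x v =
      ℓ (∑ j ∈ Finset.range N, ε • fderiv ℝ (eulerStep V ε)^[j] x v) := by
  have hEd : Differentiable ℝ (eulerStep V ε) := differentiable_id.add (hd.const_smul ε)
  have hsum : HasFDerivAt (fun x => ∑ j ∈ Finset.range N, ℓ ((eulerStep V ε)^[j] x))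
      (∑ j ∈ Finset.range N, ℓ ∘SL fderiv ℝ (eulerStep V ε)^[j] x) x :=
    .fun_sum fun j _ => (ℓ.hasFDerivAt (x := (eulerStep V ε)^[j] x)).comp x
      (hEd.iterate j x).hasFDerivAt
  have havg := hsum.mul_const (N : ℝ)⁻¹
  simp only [← div_eq_mul_inv] at havg
  rw [show fderiv ℝ (eulerAverage V ℓ ε N) x = _ from havg.fderiv, ← Finset.smul_sum, map_smul,
    map_sum]
  simp only [smul_apply, sum_apply, ContinuousLinearMap.comp_apply, smul_eq_mul]
  field_simp

theorem sum_smul_iterate_eulerStep (n : ℕ) (x : E) :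
    ∑ j ∈ Finset.range n, ε • V ((eulerStep V ε)^[j] x) = (eulerStep V ε)^[n] x - x := by
  simpa only [Function.iterate_succ_apply', Function.iterate_zero_apply, eulerStep,
    add_sub_cancel_left] using Finset.sum_range_sub (fun j => (eulerStep V ε)^[j] x) n

theorem IsFlowOf.norm_mul_fderiv_eulerAverage_sub_le {ψ : Flow ℝ E} (h : IsFlowOf V ψ)
    (hd : Differentiable ℝ V) (hV : LipschitzWith K V) (hV' : LipschitzWith K' (fderiv ℝ V))
    (hL : ∀ x, ‖V x‖ ≤ L) (ℓ : E →L[ℝ] ℝ) {T : ℝ} (hε : 0 ≤ ε) {N : ℕ} (hN : N ≠ 0)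
    (hT : N * ε = T) (x : E) :
    ‖T * fderiv ℝ (eulerAverage V ℓ ε N) x (V x) - ℓ (ψ T x - x)‖ ≤
      ‖ℓ‖ * ((T * (T * K' * L ^ 2) + T * K * L) * Real.exp (T * K)) * ε := by
  have hT0 : 0 ≤ T := hT ▸ by positivity
  let y (j : ℕ) : E := (eulerStep V ε)^[j] x
  let w (j : ℕ) : E := fderiv ℝ (eulerStep V ε)^[j] x (V x) - V (y j)
  have hw (j : ℕ) (hj : j ∈ Finset.range N) :
      ‖ε • w j‖ ≤ ε * (T * (K' * L ^ 2 * ε) * Real.exp (T * K)) := by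
    have hjT : j * ε ≤ T := hT ▸ by gcongr; exact (Finset.mem_range.1 hj).le
    rw [norm_smul_of_nonneg hε]
    gcongr
    calc ‖w j‖ ≤ j * (K' * L ^ 2 * ε ^ 2) * Real.exp (j * (ε * K)) :=
          norm_fderiv_iterate_eulerStep_sub_le hd hV hV' hL hε j x
      _ = j * ε * (K' * L ^ 2 * ε) * Real.exp (j * ε * K) := by ring_nf
      _ ≤ T * (K' * L ^ 2 * ε) * Real.exp (T * K) := by gcongr
  have hy : ‖ψ T x - y N‖ ≤ T * (K * L * ε) * Real.exp (T * K) := by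
    calc ‖ψ T x - y N‖ ≤ N * (K * L * ε ^ 2) * Real.exp (N * (ε * K)) :=
          hT ▸ h.norm_apply_sub_iterate_eulerStep_le hV hL hε N x
      _ = T * (K * L * ε) * Real.exp (T * K) := by rw [← hT]; ring_nf
  have hsum : T * fderiv ℝ (eulerAverage V ℓ ε N) x (V x) - ℓ (ψ T x - x) =
      ℓ (∑ j ∈ Finset.range N, ε • w j - (ψ T x - y N)) := by
    rw [← hT, mul_fderiv_eulerAverage_apply hd ℓ hN, ← map_sub, hT]
    simp only [w, y, smul_sub, Finset.sum_sub_distrib, sum_smul_iterate_eulerStep]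
    congr 1
    abel
  calc _ ≤ ‖ℓ‖ * ‖∑ j ∈ Finset.range N, ε • w j - (ψ T x - y N)‖ := hsum ▸ ℓ.le_opNorm _
    _ ≤ ‖ℓ‖ * (N * (ε * (T * (K' * L ^ 2 * ε) * Real.exp (T * K))) +
        T * (K * L * ε) * Real.exp (T * K)) := by
      gcongr
      refine norm_sub_le_of_le ((norm_sum_le_of_le _ hw).trans_eq ?_) hy
      rw [Finset.sum_const, Finset.card_range, nsmul_eq_mul]
    _ = _ := by rw [← mul_assoc (N : ℝ), hT]; ring

theorem IsFlowOf.exists_fderiv_eulerAverage_pos {ψ : Flow ℝ E} (h : IsFlowOf V ψ)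
    (hd : Differentiable ℝ V) (hV : LipschitzWith K V) (hV' : LipschitzWith K' (fderiv ℝ V))
    (hL : ∀ x, ‖V x‖ ≤ L) (ℓ : E →L[ℝ] ℝ) {T δ : ℝ} (hT : 0 < T) (hδ : 0 < δ)
    (hℓ : ∀ x, ℓ x + δ ≤ ℓ (ψ T x)) :
    ∃ ε, ∃ N ≠ 0, ∀ x, 0 < fderiv ℝ (eulerAverage V ℓ ε N) x (V x) := by
  set C := ‖ℓ‖ * ((T * (T * K' * L ^ 2) + T * K * L) * Real.exp (T * K))
  have hlim : Tendsto (fun N : ℕ => C * (T / N)) atTop (𝓝 0) := by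
    simpa using (tendsto_const_div_atTop_nhds_zero_nat T).const_mul C
  obtain ⟨N, hlt, hN⟩ := ((hlim.eventually_lt_const hδ).and (eventually_ne_atTop 0)).exists
  refine ⟨T / N, N, hN, fun x => pos_of_mul_pos_right (a := T) ?_ hT.le⟩
  have hclose := h.norm_mul_fderiv_eulerAverage_sub_le hd hV hV' hL ℓ (T := T) (ε := T / N)
    (by positivity) hN (by field_simp) x
  rw [map_sub] at hclose
  linarith [neg_le_of_abs_le hclose, hℓ x]

end EulerAverage

section Straightening

variable {μ : ℝ × ℝ → ℝ} {Z : ℝ × ℝ → ℝ × ℝ} {ψ : Flow ℝ (ℝ × ℝ)}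

theorem bijective_of_hasDerivAt_ge {f f' : ℝ → ℝ} {δ : ℝ} (hδ : 0 < δ)
    (hf : ∀ t, HasDerivAt f (f' t) t) (hle : ∀ t, δ ≤ f' t) : Function.Bijective f := by
  have hcont : Continuous f := continuous_iff_continuousAt.2 fun t => (hf t).continuousAt
  have hmono : Monotone fun t => f t - δ * t :=
    monotone_of_hasDerivAt_nonneg (fun t => by
      simpa using (hf t).fun_sub ((hasDerivAt_id' t).const_mul δ)) fun t => sub_nonneg.2 (hle t)
  refine ⟨(strictMono_of_hasDerivAt_pos hf fun t => hδ.trans_le (hle t)).injective,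
    hcont.surjective ?_ ?_⟩
  · refine tendsto_atTop_mono' _ ?_ (tendsto_atTop_add_const_left _ (f 0)
      (tendsto_id.const_mul_atTop hδ))
    filter_upwards [eventually_ge_atTop 0] with t ht
    simpa [le_sub_iff_add_le] using hmono ht
  · refine tendsto_atBot_mono' _ ?_ (tendsto_atBot_add_const_left _ (f 0)
      (tendsto_id.const_mul_atBot hδ))
    filter_upwards [eventually_le_atBot 0] with t ht
    simpa [sub_le_iff_le_add] using hmono ht

theorem exists_diffeomorph_of_bijective {E F : Type*} [NormedAddCommGroup E] [NormedSpace ℝ E]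
    [CompleteSpace E] [NormedAddCommGroup F] [NormedSpace ℝ F] {n : WithTop ℕ∞} (hn : n ≠ 0)
    {f : E → F} (hf : ContDiff ℝ n f) (hbij : Function.Bijective f)
    (hinv : ∀ x, (fderiv ℝ f x).IsInvertible) :
    ∃ Φ : Diffeomorph 𝓘(ℝ, E) 𝓘(ℝ, F) E F n, ⇑Φ = f := by
  choose A hA using hinv
  have hopen : IsOpenMap f := isOpenMap_of_hasStrictFDerivAt_equiv (f' := A) fun x =>
    hA x ▸ hf.contDiffAt.hasStrictFDerivAt hn
  let e := (Equiv.ofBijective f hbij).toHomeomorphOfContinuousOpen hf.continuous hopen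
  have he : ContDiff ℝ n e.symm := e.contDiff_symm
    (fun x => (hA x ▸ (hf.differentiable hn x).hasFDerivAt : HasFDerivAt f (A x : E →L[ℝ] F) x)) hf
  exact ⟨⟨e.toEquiv, hf.contMDiff, he.contMDiff⟩, rfl⟩

namespace IsPeriodicSubmersion

theorem exists_transverse (h : IsPeriodicSubmersion μ) :
    ∃ Z ψ ν, IsTangentField μ Z ∧ IsFlowOf Z ψ ∧ ContDiff ℝ ω ν ∧
      (∀ x k, ν (x + latticeVec k) = ν x + (latticeVec k).2) ∧
      ∃ δ > 0, ∀ x, δ ≤ fderiv ℝ ν x (Z x) := by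
  obtain ⟨Z, ψ, hZ, hψ, T, hT, δ, hδ, hdrift⟩ := h.exists_isTangentField_snd_add_le
  have hZ₁ : ContDiff ℝ 1 Z := hZ.contDiff.of_le le_top
  obtain ⟨K, hK⟩ := hZ.periodic.exists_lipschitzWith hZ₁
  obtain ⟨K', hK'⟩ := (latticePeriodic_fderiv (c := 0) fun x k => by
    simpa using hZ.periodic k x).exists_lipschitzWith (hZ.contDiff.fderiv_right le_top)
  obtain ⟨L, hL⟩ := hZ.periodic.exists_norm_le hZ₁.continuous
  obtain ⟨ε, N, hN, hpos⟩ := hψ.exists_fderiv_eulerAverage_pos (hZ₁.differentiable one_ne_zero)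
    hK hK' hL (.snd ℝ ℝ ℝ) hT hδ hdrift
  have hν : ContDiff ℝ ω (eulerAverage Z (ContinuousLinearMap.snd ℝ ℝ ℝ) ε N) :=
    contDiff_eulerAverage hZ.contDiff contDiff_snd N
  have hνper x k := eulerAverage_translate (ε := ε) (hZ.periodic k) hN (.snd ℝ ℝ ℝ) x
  have hderper : LatticePeriodic fun x =>
      fderiv ℝ (eulerAverage Z (ContinuousLinearMap.snd ℝ ℝ ℝ) ε N) x (Z x) := fun k x => by
    simp only [latticePeriodic_fderiv hνper k x, hZ.periodic k x]
  obtain ⟨δ', hδ', hle⟩ := hderper.exists_pos_le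
    (((hν.continuous_fderiv (by simp)).clm_apply hZ₁.continuous)) hpos
  exact ⟨Z, ψ, _, hZ, hψ, hν, hνper, δ', hδ', hle⟩

theorem bijective_prodMk (h : IsPeriodicSubmersion μ) (hZ : IsTangentField μ Z)
    (hψ : IsFlowOf Z ψ) {ν : ℝ × ℝ → ℝ} (hν : Differentiable ℝ ν) {δ : ℝ} (hδ : 0 < δ)
    (hle : ∀ x, δ ≤ fderiv ℝ ν x (Z x)) : Function.Bijective fun x => (μ x, ν x) := by
  have horbit (x : ℝ × ℝ) : Function.Bijective fun t => ν (ψ t x) :=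
    bijective_of_hasDerivAt_ge hδ (hψ.hasDerivAt_comp hν x) fun t => hle _
  refine ⟨fun x y hxy => ?_, fun ⟨c, s⟩ => ?_⟩
  · obtain ⟨hμ, hν⟩ := Prod.ext_iff.1 hxy
    obtain ⟨t, rfl⟩ := h.exists_flow_eq hZ hψ hμ
    obtain rfl : 0 = t := (horbit x).1 (by simpa using hν)
    rw [ψ.map_zero_apply]
  · obtain ⟨x, rfl⟩ := h.surjective c
    obtain ⟨t, rfl⟩ := (horbit x).2 s
    exact ⟨ψ t x, Prod.ext (h.comp_flow hZ hψ t x) rfl⟩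

theorem exists_straightening (h : IsPeriodicSubmersion μ) :
    ∃ F : Diffeomorph 𝓘(ℝ, ℝ × ℝ) 𝓘(ℝ, ℝ × ℝ) (ℝ × ℝ) (ℝ × ℝ) ω,
      (∀ x k, F (x + latticeVec k) = F x + latticeVec k) ∧ ∀ x, μ (F x) = x.1 := by
  obtain ⟨Z, ψ, ν, hZ, hψ, hν, hνper, δ, hδ, hle⟩ := h.exists_transverse
  have hνd : Differentiable ℝ ν := hν.differentiable (by simp)
  have hinv (x : ℝ × ℝ) : (fderiv ℝ (fun x => (μ x, ν x)) x).IsInvertible := by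
    rw [(h.differentiable x).fderiv_prodMk (hνd x)]
    exact isInvertible_prod_of_apply_eq_zero (by simp) (h.fderiv_ne_zero x) (hZ.fderiv_apply x)
      (hδ.trans_le (hle x)).ne'
  obtain ⟨Φ, hΦ⟩ := exists_diffeomorph_of_bijective (by simp) (h.contDiff.prodMk hν)
    (h.bijective_prodMk hZ hψ hνd hδ hle) hinv
  have hΦper (x : ℝ × ℝ) (k : ℤ × ℤ) : Φ (x + latticeVec k) = Φ x + latticeVec k := by
    simp only [hΦ, h.add_latticeVec, hνper]
    rfl
  exact ⟨Φ.symm, symm_apply_add_latticeVec (F := Φ.toEquiv) (e := .refl _) hΦper,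
    fun x => congrArg Prod.fst ((congrFun hΦ _).symm.trans (Φ.apply_symm_apply x))⟩

end IsPeriodicSubmersion

end Straightening

section Cover

/-- The branch near `Circle.exp t₀` of the logarithm on the circle taking the value `t₀` there. -/
noncomputable def circleLog (t₀ : ℝ) (z : Circle) : ℝ :=
  Complex.arg (z / Circle.exp t₀ : Circle) + t₀

theorem exp_circleLog (t₀ : ℝ) (z : Circle) : Circle.exp (circleLog t₀ z) = z := by
  rw [circleLog, Circle.exp_add, Circle.exp_arg, div_mul_cancel]

theorem circleLog_exp {t₀ t : ℝ} (h : |t - t₀| < Real.pi) : circleLog t₀ (Circle.exp t) = t := by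
  rw [circleLog, ← Circle.exp_sub, Circle.arg_exp (abs_lt.1 h).1 (abs_lt.1 h).2.le, sub_add_cancel]

theorem contMDiffAt_circleLog (t₀ : ℝ) :
    ContMDiffAt (𝓡 1) 𝓘(ℝ, ℝ) ω (circleLog t₀) (Circle.exp t₀) := by
  have hlog : ContDiffAt ℝ ω Complex.arg 1 := by
    simpa only [Function.comp_def, Complex.imCLM_apply, Complex.log_im] using
      Complex.imCLM.contDiff.contDiffAt.comp (1 : ℂ)
        ((Complex.contDiffAt_log (n := ω) Complex.one_mem_slitPlane).restrict_scalars ℝ)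
  have := finrank_real_complex_fact'
  have hdiv : ContMDiff (𝓡 1) 𝓘(ℝ, ℂ) ω fun z : Circle => ((z / Circle.exp t₀ : Circle) : ℂ) :=
    contMDiff_coe_sphere.comp (contMDiff_id.div contMDiff_const)
  refine ContMDiffAt.add (ContMDiffAt.comp (Circle.exp t₀) (g := Complex.arg) (I' := 𝓘(ℝ, ℂ))
    ?_ hdiv.contMDiffAt) contMDiffAt_const
  rw [div_self', Circle.coe_one]
  exact hlog.contMDiffAt

/-- The local section of the universal covering of the torus through `x₀`. -/
noncomputable def torusSection (x₀ : ℝ × ℝ) (z : Torus2) : ℝ × ℝ :=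
  (circleLog x₀.1 z.1, circleLog x₀.2 z.2)

theorem torusCover_torusSection (x₀ : ℝ × ℝ) (z : Torus2) :
    torusCover (torusSection x₀ z) = z :=
  Prod.ext (exp_circleLog _ _) (exp_circleLog _ _)

theorem torusSection_torusCover (x₀ : ℝ × ℝ) : torusSection x₀ (torusCover x₀) = x₀ :=
  Prod.ext (circleLog_exp (by simp [Real.pi_pos])) (circleLog_exp (by simp [Real.pi_pos]))

theorem contMDiffAt_torusSection (x₀ : ℝ × ℝ) :
    ContMDiffAt ((𝓡 1).prod (𝓡 1)) 𝓘(ℝ, ℝ × ℝ) ω (torusSection x₀) (torusCover x₀) :=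
  ((contMDiffAt_circleLog x₀.1).comp (torusCover x₀) contMDiffAt_fst).prodMk_space
    ((contMDiffAt_circleLog x₀.2).comp (torusCover x₀) contMDiffAt_snd)

theorem contMDiff_torusCover :
    ContMDiff 𝓘(ℝ, ℝ × ℝ) ((𝓡 1).prod (𝓡 1)) ω torusCover :=
  (contMDiff_circleExp.comp contDiff_fst.contMDiff).prodMk
    (contMDiff_circleExp.comp contDiff_snd.contMDiff)

theorem surjective_torusCover : Function.Surjective torusCover := fun z =>
  ⟨_, torusCover_torusSection 0 z⟩

theorem torusCover_eq_iff {x y : ℝ × ℝ} :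
    torusCover x = torusCover y ↔ ∃ k, x = y + latticeVec k := by
  simp only [torusCover, Prod.ext_iff, Circle.exp_eq_exp, Prod.exists, latticeVec, Prod.fst_add,
    Prod.snd_add, exists_and_left, exists_and_right, mul_comm (2 * Real.pi)]

theorem latticePeriodic_torusCover : LatticePeriodic torusCover := fun k _ =>
  torusCover_eq_iff.2 ⟨k, rfl⟩

/-- The map induced on the torus by a lattice periodic map of the plane, defined by means of
the section with values in `(-π, π]²`. -/
noncomputable def torusDescend {X : Type*} (f : ℝ × ℝ → X) (z : Torus2) : X :=
  f (torusSection 0 z)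

theorem torusDescend_torusCover {X : Type*} {f : ℝ × ℝ → X} (hf : LatticePeriodic f)
    (x : ℝ × ℝ) : torusDescend f (torusCover x) = f x := by
  obtain ⟨k, hk⟩ := torusCover_eq_iff.1 (torusCover_torusSection 0 (torusCover x))
  rw [torusDescend, hk, hf k x]

theorem torusDescend_eq {X : Type*} {f : ℝ × ℝ → X} (hf : LatticePeriodic f) (x₀ : ℝ × ℝ) :
    torusDescend f = fun z => f (torusSection x₀ z) := by
  ext z
  rw [← torusDescend_torusCover hf, torusCover_torusSection]

theorem contMDiff_torusDescend {E H M : Type*} [NormedAddCommGroup E] [NormedSpace ℝ E]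
    [TopologicalSpace H] {I : ModelWithCorners ℝ E H} [TopologicalSpace M] [ChartedSpace H M]
    {f : ℝ × ℝ → M} (hf : LatticePeriodic f) (hc : ContMDiff 𝓘(ℝ, ℝ × ℝ) I ω f) :
    ContMDiff ((𝓡 1).prod (𝓡 1)) I ω (torusDescend f) := by
  intro z
  obtain ⟨x, rfl⟩ := surjective_torusCover z
  rw [torusDescend_eq hf x]
  exact hc.contMDiffAt.comp (torusCover x) (contMDiffAt_torusSection x)

theorem exists_torusAnalyticDiffeo (F : Diffeomorph 𝓘(ℝ, ℝ × ℝ) 𝓘(ℝ, ℝ × ℝ) (ℝ × ℝ) (ℝ × ℝ) ω)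
    (e : ℤ × ℤ ≃ ℤ × ℤ) (hF : ∀ x k, F (x + latticeVec k) = F x + latticeVec (e k)) :
    ∃ Ψ : TorusAnalyticDiffeo, ∀ x, Ψ (torusCover x) = torusCover (F x) := by
  have hF_symm (x : ℝ × ℝ) (k : ℤ × ℤ) :
      F.symm (x + latticeVec k) = F.symm x + latticeVec (e.symm k) :=
    symm_apply_add_latticeVec (F := F.toEquiv) hF x k
  have hper : LatticePeriodic fun x => torusCover (F x) := fun k x => by
    simp only [hF, latticePeriodic_torusCover _ _]
  have hper_symm : LatticePeriodic fun x => torusCover (F.symm x) := fun k x => by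
    simp only [hF_symm, latticePeriodic_torusCover _ _]
  refine ⟨⟨⟨torusDescend fun x => torusCover (F x), torusDescend fun x => torusCover (F.symm x),
      fun z => ?_, fun z => ?_⟩,
    contMDiff_torusDescend hper (contMDiff_torusCover.comp F.contMDiff),
    contMDiff_torusDescend hper_symm (contMDiff_torusCover.comp F.symm.contMDiff)⟩,
    torusDescend_torusCover hper⟩
  all_goals
    obtain ⟨x, rfl⟩ := surjective_torusCover z
    simp only [torusDescend_torusCover hper, torusDescend_torusCover hper_symm,
      F.symm_apply_apply, F.apply_symm_apply]

end Cover

section Lift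

theorem exists_continuous_lift {X : Type*} [TopologicalSpace X] [SimplyConnectedSpace X]
    [LocallyPathConnectedSpace X] {f : X → Circle} (hf : Continuous f) :
    ∃ m : X → ℝ, Continuous m ∧ ∀ x, Circle.exp (m x) = f x := by
  obtain ⟨x₀⟩ := PathConnectedSpace.nonempty (X := X)
  obtain ⟨F, ⟨-, hF⟩, -⟩ := Circle.isCoveringMap_exp.existsUnique_continuousMap_lifts
    (⟨f, hf⟩ : C(X, Circle)) x₀ (Complex.arg (f x₀)) (Circle.exp_arg _)
  exact ⟨F, F.continuous, fun x => congrFun hF x⟩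

theorem contDiff_of_contMDiff_exp_comp {E : Type*} [NormedAddCommGroup E] [NormedSpace ℝ E]
    {m : E → ℝ} (hm : Continuous m)
    (h : ContMDiff 𝓘(ℝ, E) (𝓡 1) ω fun x => Circle.exp (m x)) : ContDiff ℝ ω m := by
  refine contDiff_iff_contDiffAt.2 fun x => ?_
  have hlog : ContMDiffAt 𝓘(ℝ, E) 𝓘(ℝ, ℝ) ω (fun y => circleLog (m x) (Circle.exp (m y))) x :=
    (contMDiffAt_circleLog (m x)).comp x h.contMDiffAt
  refine hlog.contDiffAt.congr_of_eventuallyEq ?_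
  filter_upwards [hm.continuousAt.eventually (Metric.ball_mem_nhds (m x) Real.pi_pos)] with y hy
  exact (circleLog_exp hy).symm

theorem exists_eq_add_two_pi_mul_int {X : Type*} [TopologicalSpace X] [ConnectedSpace X]
    {f g : X → ℝ} (hf : Continuous f) (hg : Continuous g)
    (hfg : ∀ x, Circle.exp (f x) = Circle.exp (g x)) :
    ∃ a : ℤ, ∀ x, f x = g x + 2 * Real.pi * a := by
  choose n hn using fun x => Circle.exp_eq_exp.1 (hfg x)
  have hcont : Continuous n := by
    rw [Int.isClosedEmbedding_coe_real.continuous_iff]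
    have : ((↑) : ℤ → ℝ) ∘ n = fun x => (f x - g x) / (2 * Real.pi) := by
      ext x
      rw [Function.comp, hn x, add_sub_cancel_left, mul_div_cancel_right₀ _ Real.two_pi_pos.ne']
    exact this ▸ (hf.sub hg).div_const _
  obtain ⟨x₀⟩ := ConnectedSpace.toNonempty (α := X)
  refine ⟨n x₀, fun x => ?_⟩
  rw [hn x, PreconnectedSpace.constant inferInstance hcont (x := x) (y := x₀), mul_comm]

end Lift

section Fibration

theorem LatticePeriodic.exists_fderiv_eq_zero {f : ℝ × ℝ → ℝ} (hf : LatticePeriodic f)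
    (hc : Continuous f) : ∃ x, fderiv ℝ f x = 0 := by
  obtain ⟨-, ⟨x, rfl⟩, hx⟩ := (hf.isCompact_range hc).exists_isGreatest (range_nonempty f)
  exact ⟨x, IsLocalMax.fderiv_eq_zero (Eventually.of_forall fun y => hx (mem_range_self y))⟩

/-- The linear automorphism of `R²` with matrix `((p, -b), (q, a))`, which carries the linear form
`a x₁ + b x₂` to the first coordinate. -/
def unimodularEquiv {R : Type*} [CommRing R] {a b p q : R} (h : a * p + b * q = 1) :
    (R × R) ≃ₗ[R] R × R where
  toFun x := (p * x.1 - b * x.2, q * x.1 + a * x.2)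
  invFun x := (a * x.1 + b * x.2, p * x.2 - q * x.1)
  map_add' x y := by ext <;> simp only [Prod.fst_add, Prod.snd_add] <;> ring
  map_smul' c x := by
    ext <;> simp only [Prod.smul_fst, Prod.smul_snd, smul_eq_mul, RingHom.id_apply] <;> ring
  left_inv x := Prod.ext (by linear_combination x.1 * h) (by linear_combination x.2 * h)
  right_inv x := Prod.ext (by linear_combination x.1 * h) (by linear_combination x.2 * h)

theorem exists_unimodular_change {a b : ℤ} (hab : a ≠ 0 ∨ b ≠ 0) :
    ∃ (U : (ℝ × ℝ) ≃L[ℝ] ℝ × ℝ) (e : ℤ × ℤ ≃ ℤ × ℤ) (d : ℕ), d ≠ 0 ∧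
      (∀ k, U (latticeVec k) = latticeVec (e k)) ∧ ∀ x, a * (U x).1 + b * (U x).2 = d * x.1 := by
  obtain ⟨d, a, b, hd, hcop, rfl, rfl⟩ := Int.exists_gcd_one' (Int.gcd_pos_iff.2 hab)
  obtain ⟨p, q, h⟩ := Int.isCoprime_iff_gcd_eq_one.2 hcop
  have hℤ : a * p + b * q = 1 := by linear_combination h
  have hℝ : (a * p + b * q : ℝ) = 1 := by exact_mod_cast hℤ
  refine ⟨(unimodularEquiv hℝ).toContinuousLinearEquiv, (unimodularEquiv hℤ).toEquiv, d, hd.ne',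
    fun k => ?_, fun x => ?_⟩
  · ext <;> simp [unimodularEquiv, latticeVec] <;> ring
  · push_cast
    change a * d * (p * x.1 - b * x.2) + b * d * (q * x.1 + a * x.2) = d * x.1
    linear_combination d * x.1 * hℝ

theorem exists_latticePeriodic_sub_of_exp {m : ℝ × ℝ → ℝ} (hm : Continuous m)
    (hper : LatticePeriodic fun x => Circle.exp (m x)) :
    ∃ a b : ℤ, LatticePeriodic fun x => m x - (a * x.1 + b * x.2) := by
  have htrans (k : ℤ × ℤ) : ∃ n : ℤ, ∀ x, m (x + latticeVec k) = m x + 2 * Real.pi * n :=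
    exists_eq_add_two_pi_mul_int (by fun_prop) hm (hper k)
  obtain ⟨a, ha⟩ := htrans (1, 0)
  obtain ⟨b, hb⟩ := htrans (0, 1)
  refine ⟨a, b, IsTwoPiPeriodic.latticePeriodic fun x y => ⟨?_, ?_⟩⟩
  · have hshift : m (x + 2 * Real.pi, y) = m (x, y) + 2 * Real.pi * a := by
      simpa [latticeVec] using ha (x, y)
    linear_combination hshift
  · have hshift : m (x, y + 2 * Real.pi) = m (x, y) + 2 * Real.pi * b := by
      simpa [latticeVec] using hb (x, y)
    linear_combination hshift

theorem exists_isPeriodicSubmersion_comp {m : ℝ × ℝ → ℝ} (hm : ContDiff ℝ ω m)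
    (hm' : ∀ x, fderiv ℝ m x ≠ 0) (hper : LatticePeriodic fun x => Circle.exp (m x)) :
    ∃ (U : (ℝ × ℝ) ≃L[ℝ] ℝ × ℝ) (e : ℤ × ℤ ≃ ℤ × ℤ) (d : ℕ), d ≠ 0 ∧
      (∀ k, U (latticeVec k) = latticeVec (e k)) ∧
      IsPeriodicSubmersion fun x => (d : ℝ)⁻¹ * m (U x) := by
  obtain ⟨a, b, hab⟩ := exists_latticePeriodic_sub_of_exp hm.continuous hper
  have hne : a ≠ 0 ∨ b ≠ 0 := by
    by_contra! h
    obtain ⟨rfl, rfl⟩ := h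
    obtain ⟨x, hx⟩ := LatticePeriodic.exists_fderiv_eq_zero (by simpa using hab) hm.continuous
    exact hm' x hx
  obtain ⟨U, e, d, hd, hUe, hU⟩ := exists_unimodular_change hne
  have hd' : (d : ℝ) ≠ 0 := Nat.cast_ne_zero.2 hd
  refine ⟨U, e, d, hd, hUe, ⟨contDiff_const.mul (hm.comp U.contDiff), fun k x => ?_, fun x => ?_⟩⟩
  · have hshift := hab (e k) (U x)
    simp only [← hUe, ← map_add, hU] at hshift
    have hshift' := congrArg ((d : ℝ)⁻¹ * ·) hshift
    simpa only [mul_sub, inv_mul_cancel_left₀ hd'] using hshift'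
  · have hmd : Differentiable ℝ m := hm.differentiable (by simp)
    have hderiv := ((hmd (U x)).hasFDerivAt.comp x U.hasFDerivAt).const_mul (d : ℝ)⁻¹
    intro h0
    refine hm' (U x) (ContinuousLinearMap.ext fun v => ?_)
    simpa [hd] using DFunLike.congr_fun (hderiv.fderiv.symm.trans h0) (U.symm v)

theorem eq_one_of_isPreconnected_pow_eq_one {d : ℕ} (hd : d ≠ 0)
    (h : IsPreconnected {w : Circle | w ^ d = 1}) : d = 1 := by
  have hfin : {w : Circle | w ^ d = 1}.Finite := by
    refine ((Polynomial.nthRootsFinset d (1 : ℂ)).finite_toSet.preimage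
      Circle.coe_injective.injOn).subset fun w (hw : w ^ d = 1) => ?_
    simpa [Polynomial.mem_nthRootsFinset (Nat.pos_of_ne_zero hd)] using
      congrArg ((↑) : Circle → ℂ) hw
  have hprim : IsPrimitiveRoot (Circle.exp (2 * Real.pi / d)) d := by
    refine IsPrimitiveRoot.of_map_of_injective (f := Circle.coeHom) ?_ Circle.coe_injective
    convert! Complex.isPrimitiveRoot_exp d hd using 1
    rw [show Circle.coeHom (Circle.exp _) = _ from Circle.coe_exp _]
    push_cast
    ring_nf
  have hone : Circle.exp (2 * Real.pi / d) = 1 :=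
    hfin.countable.isTotallyDisconnected _ subset_rfl h hprim.pow_eq_one (one_pow d)
  exact (hone ▸ hprim).unique IsPrimitiveRoot.one

namespace IsAnalyticCircleFibration

variable {τ : Torus2 → Circle}

theorem fderiv_lift_ne_zero (hτ : IsAnalyticCircleFibration τ) {m : ℝ × ℝ → ℝ}
    (hm : Differentiable ℝ m) (hmτ : ∀ x, Circle.exp (m x) = τ (torusCover x)) (x : ℝ × ℝ) :
    fderiv ℝ m x ≠ 0 := by
  intro h0
  have hτ_eq : τ = Circle.exp ∘ (m ∘ torusSection x) := by
    ext z
    simp only [Function.comp, hmτ, torusCover_torusSection]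
  have hsection := ((contMDiffAt_torusSection x).mdifferentiableAt (by simp)).hasMFDerivAt
  have hm_zero : HasMFDerivAt 𝓘(ℝ, ℝ × ℝ) 𝓘(ℝ, ℝ) m (torusSection x (torusCover x))
      (0 : ℝ × ℝ →L[ℝ] ℝ) := by
    rw [torusSection_torusCover, ← h0]
    exact (hm x).hasFDerivAt.hasMFDerivAt
  have hexp := ((contMDiff_circleExp (m := ω)).contMDiffAt.mdifferentiableAt
    (x := (m ∘ torusSection x) (torusCover x)) (by simp)).hasMFDerivAt
  have hcomp := (hexp.comp (torusCover x) (hm_zero.comp (torusCover x) hsection)).mfderiv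
  have hsurj := hτ.submersion (torusCover x)
  rw [hτ_eq, hcomp] at hsurj
  obtain ⟨v, hv⟩ := exists_ne (0 : EuclideanSpace ℝ (Fin 1))
  obtain ⟨u, hu⟩ := hsurj v
  exact hv (hu.symm.trans
    (map_zero (mfderiv 𝓘(ℝ, ℝ) (𝓡 1) Circle.exp ((m ∘ torusSection x) (torusCover x)))))

theorem exists_isPeriodicSubmersion_lift (hτ : IsAnalyticCircleFibration τ) :
    ∃ (U : (ℝ × ℝ) ≃L[ℝ] ℝ × ℝ) (e : ℤ × ℤ ≃ ℤ × ℤ) (d : ℕ) (μ : ℝ × ℝ → ℝ), d ≠ 0 ∧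
      (∀ k, U (latticeVec k) = latticeVec (e k)) ∧ IsPeriodicSubmersion μ ∧
      ∀ x, τ (torusCover (U x)) = Circle.exp (μ x) ^ d := by
  have hcover : ContMDiff 𝓘(ℝ, ℝ × ℝ) (𝓡 1) ω fun x => τ (torusCover x) :=
    hτ.analytic.comp contMDiff_torusCover
  obtain ⟨m, hmc, hmτ⟩ := exists_continuous_lift hcover.continuous
  have hm : ContDiff ℝ ω m := contDiff_of_contMDiff_exp_comp hmc (by simpa only [hmτ] using hcover)
  obtain ⟨U, e, d, hd, hUe, hμ⟩ := exists_isPeriodicSubmersion_comp hm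
    (hτ.fderiv_lift_ne_zero (hm.differentiable (by simp)) hmτ) fun k x => by
      simp only [hmτ, latticePeriodic_torusCover k x]
  refine ⟨U, e, d, _, hd, hUe, hμ, fun x => ?_⟩
  rw [← hmτ, ← Circle.exp_nsmul, nsmul_eq_mul, mul_inv_cancel_left₀ (Nat.cast_ne_zero.2 hd)]

theorem exists_apply_eq_pow (hτ : IsAnalyticCircleFibration τ) :
    ∃ (Ψ : TorusAnalyticDiffeo) (d : ℕ), d ≠ 0 ∧ ∀ z, τ (Ψ z) = z.1 ^ d := by
  obtain ⟨U, e, d, μ, hd, hUe, hμ, hτμ⟩ := hτ.exists_isPeriodicSubmersion_lift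
  obtain ⟨F, hF, hμF⟩ := hμ.exists_straightening
  let U' : Diffeomorph 𝓘(ℝ, ℝ × ℝ) 𝓘(ℝ, ℝ × ℝ) (ℝ × ℝ) (ℝ × ℝ) ω :=
    ⟨U.toEquiv, U.contDiff.contMDiff, U.symm.contDiff.contMDiff⟩
  obtain ⟨Ψ, hΨ⟩ := exists_torusAnalyticDiffeo (F.trans U') e
    fun x k => (congrArg U (hF x k)).trans (by rw [map_add, hUe]; rfl)
  refine ⟨Ψ, d, hd, fun z => ?_⟩
  obtain ⟨x, rfl⟩ := surjective_torusCover z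
  exact (congrArg τ (hΨ x)).trans ((hτμ (F x)).trans (by rw [hμF]; rfl))

theorem exists_trivialization (hτ : IsAnalyticCircleFibration τ) :
    ∃ Ψ : TorusAnalyticDiffeo, ∀ z : Torus2, τ (Ψ z) = z.1 := by
  obtain ⟨Ψ, d, hd, hΨ⟩ := hτ.exists_apply_eq_pow
  have himage : (fun z => (Ψ.symm z).1) '' (τ ⁻¹' {1}) = {w : Circle | w ^ d = 1} := by
    ext w
    refine ⟨?_, fun hw => ⟨Ψ (w, 1), (hΨ _).trans hw, congrArg Prod.fst (Ψ.symm_apply_apply _)⟩⟩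
    rintro ⟨z, hz, rfl⟩
    exact (hΨ _).symm.trans ((congrArg τ (Ψ.apply_symm_apply z)).trans hz)
  obtain rfl : d = 1 := eq_one_of_isPreconnected_pow_eq_one hd
    (himage ▸ (hτ.connected_fibre 1).isPreconnected.image _
      (continuous_fst.comp Ψ.symm.continuous).continuousOn)
  exact ⟨Ψ, fun z => (hΨ z).trans (pow_one _)⟩

end IsAnalyticCircleFibration

end Fibration

theorem proposition2p1 :
    (∀ h : ℝ × ℝ → ℝ,
      AnalyticOnNhd ℝ h Set.univ →
      IsTwoPiPeriodic h →
      (∀ θ : ℝ × ℝ, fderiv ℝ (fun p : ℝ × ℝ => p.1 + h p) θ ≠ 0) →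
      ∃ Ψ : TorusAnalyticDiffeo, ∃ F : ℝ × ℝ → ℝ × ℝ,
        IsTorusLifting F Ψ ∧ ∀ θ : ℝ × ℝ, (F θ).1 + h (F θ) = θ.1) ∧
    (∀ τ : Torus2 → Circle,
      IsAnalyticCircleFibration τ →
      ∃ Ψ : TorusAnalyticDiffeo, ∀ z : Torus2, τ (Ψ z) = z.1) := by
  refine ⟨fun h han hper hd => ?_, fun τ hτ => hτ.exists_trivialization⟩
  have hμ : IsPeriodicSubmersion fun p : ℝ × ℝ => p.1 + h p :=
    { contDiff := contDiff_fst.add (contDiffOn_univ.1 (han.contDiffOn uniqueDiffOn_univ))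
      periodic := by simpa only [add_sub_cancel_left] using hper.latticePeriodic
      fderiv_ne_zero := hd }
  obtain ⟨F, hF, hμF⟩ := hμ.exists_straightening
  obtain ⟨Ψ, hΨ⟩ := exists_torusAnalyticDiffeo F (Equiv.refl _) hF
  exact ⟨Ψ, F, ⟨F.continuous, fun θ => (hΨ θ).symm⟩, hμF⟩
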